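/- For $a>0$ let $f:\mathbb{R}\to\mathbb{R}$ be the truncation function $f(x)=x$ if $|x|\le a$ and $f(x)=0$ if $|x|>a$. For $\alpha\in\mathbb{R}^n$ let $p(x)=\sum_{i=1}^n\alpha_i x_i$, and for $x\in\mathbb{R}^n$ write $f(x)=(f(x_1),\dots,f(x_n))$. There are universal constants $c,C>0$ (independent of $n$, $\alpha$, $a$ and $\delta$) such that: 1. For every $n\ge 0$, every $\alpha\in\mathbb{R}^n$, every $a>0$ and every $\delta\in(0,1]$, $$\Pr_{x\sim\mathcal N(0,I_n)}\big[\,|p(f(x))|\le\min\{a,0.1\}\cdot\delta\cdot\|\alpha\|_2\,\big]\ \ge\ c\,\delta .$$ 2. (Anti-concentration of sums of truncated Gaussians.) For every $n\ge 1$, every $\alpha\in\mathbb{R}^n\setminus\{0\}$, every $a>0$ and every $\delta>0$, $$\Pr_{x\sim\mathcal N(0,I_n)}\Big[\,|p(f(x))|\le\min\{a,0.1\}\cdot\delta\cdot\|\alpha\|_2\ \Big|\ |x_i|\le a \text{ for all } i\Big]\ \le\ C\,\delta ,$$ that is, the bound holds when the coordinates of $x$ are i.i.d. with the standard Gaussian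 law conditioned on $[-a,a]$ (on this event $f(x)=x$). -/

import Mathlib

open MeasureTheory ProbabilityTheory

noncomputable section

/-- The truncation function at level `a`: it keeps `x` if `|x| ≤ a` and returns `0` otherwise. -/
def trunc (a x : ℝ) : ℝ := if |x| ≤ a then x else 0

/-- The linear form `p(x) = ∑ i, α i * x i`. -/
def linForm {n : ℕ} (α : EuclideanSpace ℝ (Fin n)) (x : Fin n → ℝ) : ℝ := ∑ i, α i * x i

/-- The law of `n` i.i.d. standard Gaussian random variables. -/
def stdGaussianLaw (n : ℕ) : Measure (Fin n → ℝ) := Measure.pi fun _ => gaussianReal 0 1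

/-- The law of `n` i.i.d. Gaussians truncated at level `a`: the standard Gaussian law
conditioned on all coordinates being at most `a` in absolute value. -/
def truncGaussianLaw (n : ℕ) (a : ℝ) : Measure (Fin n → ℝ) :=
  cond (stdGaussianLaw n) {x | ∀ i, |x i| ≤ a}

/-- The event `|p(f(x))| ≤ min{a, 0.1} · δ · ‖α‖₂`, with `f = trunc a` applied coordinatewise. -/
def smallBall {n : ℕ} (α : EuclideanSpace ℝ (Fin n)) (a δ : ℝ) : Set (Fin n → ℝ) :=
  {x | |linForm α (fun i => trunc a (x i))| ≤ min a (1 / 10) * δ * ‖α‖}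

end

/-! Both halves rest on even unimodal functions. A law is treated as symmetric unimodal when
averaging translates against it preserves this class. This holds for even unimodal densities
(`UnimodalFun.lintegral_mul`) and for mixtures with an atom at 0, hence for the law of a truncated
Gaussian, and it passes to sums of independent scaled copies.

Lower bound: among all windows of a given width, the sum gives most mass to the one centred at 0.
Chebyshev puts mass at least 3/4 in a window of radius of order `min a (1/10) * ‖α‖`. Covering that
window by O(1/δ) translates of the small ball leaves the central one with mass of order δ.

Upper bound: with `m = min a (1/10)`, the conditioned Gaussian has density at most `1/m`, so it is
less peaked than the uniform law on `[-m/2, m/2]`, and hence than the triangular law there.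
Peakedness comparison survives independent sums (`LessPeaked.lintegral_pi_le`), so the average of
`exp (-S²/2)` may be bounded for triangular summands. By Fourier duality that is a Gaussian average
of a product of characteristic functions. The triangular law is used because its characteristic
function is a squared sinc, bounded by the integrable `1 / (1 + const * u²)`; a single uniform
variable would decay only like `1/u`. -/

open scoped ENNReal

/-! ### Even unimodal functions and their convolutions -/

/-- A measurable function that is even and nonincreasing in the distance from the origin. -/
structure UnimodalFun (F : ℝ → ℝ≥0∞) : Prop where
  measurable : Measurable F
  anti : ∀ ⦃x y : ℝ⦄, |x| ≤ |y| → F y ≤ F x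

/-- A measure on the line averaging against which preserves even unimodal functions. -/
def SymmUnimodal (μ : Measure ℝ) : Prop :=
  ∀ F, UnimodalFun F → UnimodalFun fun c => ∫⁻ y, F (c + y) ∂μ

/-- The peakedness order: `μ` gives smaller averages than `ν` to all even unimodal functions. -/
def LessPeaked (μ ν : Measure ℝ) : Prop :=
  ∀ F, UnimodalFun F → ∫⁻ y, F y ∂μ ≤ ∫⁻ y, F y ∂ν

theorem ENNReal.mul_add_mul_le_of_le {a b c d : ℝ≥0∞} (hab : a ≤ b) (hcd : c ≤ d) :
    a * d + b * c ≤ a * c + b * d := by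
  obtain ⟨e, rfl⟩ := exists_add_of_le hab
  obtain ⟨f, rfl⟩ := exists_add_of_le hcd
  calc a * (c + f) + (a + e) * c = a * c + (a * c + a * f + e * c) := by ring
    _ ≤ a * c + (a * c + a * f + e * c + e * f) := add_le_add_right le_self_add _
    _ = _ := by ring

namespace UnimodalFun

variable {F G : ℝ → ℝ≥0∞}

theorem neg_eq (hF : UnimodalFun F) (x : ℝ) : F (-x) = F x :=
  le_antisymm (hF.anti (by simp)) (hF.anti (by simp))

theorem of_abs (hm : Measurable F) (he : ∀ x, F |x| = F x)
    (h : ∀ x y, 0 ≤ x → x ≤ y → F y ≤ F x) : UnimodalFun F :=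
  ⟨hm, fun x y hxy => by rw [← he x, ← he y]; exact h _ _ (abs_nonneg x) hxy⟩

theorem add (hF : UnimodalFun F) (hG : UnimodalFun G) : UnimodalFun fun x => F x + G x :=
  ⟨hF.measurable.add hG.measurable, fun _ _ h => add_le_add (hF.anti h) (hG.anti h)⟩

theorem mul (hF : UnimodalFun F) (hG : UnimodalFun G) : UnimodalFun fun x => F x * G x :=
  ⟨hF.measurable.mul hG.measurable, fun _ _ h => mul_le_mul' (hF.anti h) (hG.anti h)⟩

theorem const_mul (hF : UnimodalFun F) (k : ℝ≥0∞) : UnimodalFun fun x => k * F x :=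
  ⟨hF.measurable.const_mul k, fun _ _ h => mul_le_mul_right (hF.anti h) k⟩

theorem comp_mul_left (hF : UnimodalFun F) (r : ℝ) : UnimodalFun fun x => F (r * x) :=
  ⟨hF.measurable.comp (measurable_const_mul r), fun x y h => hF.anti (by
    rw [abs_mul, abs_mul]; gcongr)⟩

theorem indicator_abs_le (s : ℝ) (k : ℝ≥0∞) :
    UnimodalFun ({x : ℝ | |x| ≤ s}.indicator fun _ => k) := by
  refine ⟨measurable_const.indicator (measurableSet_le (by fun_prop) (by fun_prop)),
    fun x y h => ?_⟩
  by_cases hy : |y| ≤ s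
  · simp [Set.indicator, hy, h.trans hy]
  · simp [Set.indicator, hy]

/-- Convolving two even unimodal functions gives an even unimodal function. -/
theorem lintegral_mul (hF : UnimodalFun F) (hG : UnimodalFun G) :
    UnimodalFun fun c => ∫⁻ y, F (c + y) * G y := by
  have hFm := hF.measurable
  have hGm := hG.measurable
  refine of_abs ?_ ?_ ?_
  · exact Measurable.lintegral_prod_right' (f := fun p : ℝ × ℝ => F (p.1 + p.2) * G p.2)
      (by fun_prop)
  · intro c
    rcases abs_choice c with h | h
    · rw [h]
    · rw [h, ← lintegral_neg_eq_self]
      refine lintegral_congr fun y => ?_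
      rw [hG.neg_eq, ← hF.neg_eq]
      congr 2
      ring
  · intro c c' hc hcc
    -- Recentring at the midpoint turns the two integrals into those of `F (z ∓ d) * G (z - m)`.
    -- Averaging each with its reflection `z ↦ -z` reduces the claim to a pointwise rearrangement
    -- inequality; both sides are doubled so that no subtraction occurs in `ℝ≥0∞`.
    set m := (c + c') / 2 with hm
    set d := (c' - c) / 2 with hd
    have hm0 : 0 ≤ m := by positivity [hc.trans hcc]
    have hd0 : 0 ≤ d := by rw [hd]; linarith
    have key : ∀ e : ℝ, ∫⁻ z, F (z + e) * G (z - m) = ∫⁻ z, F (z - e) * G (z + m) := by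
      intro e
      rw [← lintegral_neg_eq_self]
      refine lintegral_congr fun y => ?_
      rw [← hG.neg_eq, ← hF.neg_eq]
      congr 2 <;> ring
    have e1 : ∫⁻ y, F (c + y) * G y = ∫⁻ z, F (z - d) * G (z - m) := by
      rw [← lintegral_sub_right_eq_self _ m]
      refine lintegral_congr fun y => ?_
      congr 2
      rw [hm, hd]; ring
    have e2 : ∫⁻ y, F (c' + y) * G y = ∫⁻ z, F (z + d) * G (z - m) := by
      rw [← lintegral_sub_right_eq_self _ m]
      refine lintegral_congr fun y => ?_
      congr 2
      rw [hm, hd]; ring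
    have k1 := key d
    have k2 : ∫⁻ z, F (z - d) * G (z - m) = ∫⁻ z, F (z + d) * G (z + m) := by
      simpa [sub_eq_add_neg] using key (-d)
    have hle : ∫⁻ z, (F (z + d) * G (z - m) + F (z - d) * G (z + m))
        ≤ ∫⁻ z, (F (z + d) * G (z + m) + F (z - d) * G (z - m)) := by
      refine lintegral_mono fun z => ?_
      rcases le_total 0 z with hz | hz
      · have h1 : F (z + d) ≤ F (z - d) := hF.anti (by
          rw [← sq_le_sq]; nlinarith)
        have h2 : G (z + m) ≤ G (z - m) := hG.anti (by
          rw [← sq_le_sq]; nlinarith)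
        exact ENNReal.mul_add_mul_le_of_le h1 h2
      · have h1 : F (z - d) ≤ F (z + d) := hF.anti (by
          rw [← sq_le_sq]; nlinarith)
        have h2 : G (z - m) ≤ G (z + m) := hG.anti (by
          rw [← sq_le_sq]; nlinarith)
        rw [add_comm, add_comm (F (z + d) * G (z + m))]
        exact ENNReal.mul_add_mul_le_of_le h1 h2
    rw [lintegral_add_left (by fun_prop), lintegral_add_left (by fun_prop), ← k1, ← k2,
      ← two_mul, ← two_mul] at hle
    rw [e1, e2]
    exact (ENNReal.mul_le_mul_iff_right (by simp) (by simp)).1 hle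

end UnimodalFun

/-! ### Symmetric unimodal measures and the peakedness order -/

namespace SymmUnimodal

variable {μ ν : Measure ℝ}

theorem dirac_zero : SymmUnimodal (Measure.dirac 0) := fun F hF => by
  have : (fun c => ∫⁻ y, F (c + y) ∂Measure.dirac 0) = F := by
    ext c
    simp
  rwa [this]

theorem add (hμ : SymmUnimodal μ) (hν : SymmUnimodal ν) : SymmUnimodal (μ + ν) := fun F hF => by
  simpa only [lintegral_add_measure] using (hμ F hF).add (hν F hF)

theorem smul (hμ : SymmUnimodal μ) (k : ℝ≥0∞) : SymmUnimodal (k • μ) := fun F hF => by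
  simpa only [lintegral_smul_measure, smul_eq_mul] using (hμ F hF).const_mul k

theorem withDensity {h : ℝ → ℝ≥0∞} (hh : UnimodalFun h) :
    SymmUnimodal (volume.withDensity h) := fun F hF => by
  have : (fun c => ∫⁻ y, F (c + y) ∂volume.withDensity h) = fun c => ∫⁻ y, F (c + y) * h y := by
    ext c
    have hm := hF.measurable
    rw [lintegral_withDensity_eq_lintegral_mul _ hh.measurable (by fun_prop)]
    exact lintegral_congr fun y => mul_comm _ _
  rw [this]
  exact hF.lintegral_mul hh

theorem map_mul_left (hμ : SymmUnimodal μ) [IsProbabilityMeasure μ] (r : ℝ) :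
    SymmUnimodal (μ.map fun x => r * x) := fun F hF => by
  have hm := hF.measurable
  have h : ∀ c, ∫⁻ y, F (c + y) ∂(μ.map fun x => r * x) = ∫⁻ y, F (c + r * y) ∂μ := fun c =>
    lintegral_map (by fun_prop) (by fun_prop)
  simp only [h]
  rcases eq_or_ne r 0 with rfl | hr
  · simpa using hF
  · have := (hμ _ (hF.comp_mul_left r)).comp_mul_left r⁻¹
    simpa [mul_add, hr] using this

end SymmUnimodal

theorem LessPeaked.trans {μ ν ρ : Measure ℝ} (h : LessPeaked μ ν) (h' : LessPeaked ν ρ) :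
    LessPeaked μ ρ := fun F hF => (h F hF).trans (h' F hF)

theorem LessPeaked.map_mul_left {μ ν : Measure ℝ} (h : LessPeaked μ ν) (r : ℝ) :
    LessPeaked (μ.map fun x => r * x) (ν.map fun x => r * x) := fun F hF => by
  rw [lintegral_map hF.measurable (by fun_prop), lintegral_map hF.measurable (by fun_prop)]
  exact h _ (hF.comp_mul_left r)

/-- Of two probability densities crossing once, the one that is larger near the origin is the more
peaked. -/
theorem LessPeaked.of_single_crossing {h u : ℝ → ℝ≥0∞} (hh : Measurable h) (hu : Measurable u)
    (hh1 : ∫⁻ x, h x = 1) (hu1 : ∫⁻ x, u x = 1) {r : ℝ}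
    (hin : ∀ x, |x| ≤ r → h x ≤ u x) (hout : ∀ x, r < |x| → u x ≤ h x) (hr : 0 ≤ r) :
    LessPeaked (volume.withDensity h) (volume.withDensity u) := fun F hF => by
  have hm := hF.measurable
  rw [lintegral_withDensity_eq_lintegral_mul _ hh hm,
    lintegral_withDensity_eq_lintegral_mul _ hu hm]
  -- This is `(F x - F r) * (u x - h x) ≥ 0` without subtraction: both factors change sign at `r`.
  -- After integration the `F r` terms agree, since both densities have mass 1.
  have hpt : ∀ x, F r * u x + F x * h x ≤ F r * h x + F x * u x := fun x => by
    rcases le_or_gt |x| r with hx | hx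
    · exact ENNReal.mul_add_mul_le_of_le (hF.anti (hx.trans (le_abs_self r))) (hin x hx)
    · have := ENNReal.mul_add_mul_le_of_le
        (hF.anti (show |r| ≤ |x| by rw [abs_of_nonneg hr]; exact hx.le)) (hout x hx)
      rw [add_comm, add_comm (F r * h x)]
      exact this
  have hint := lintegral_mono (μ := volume) hpt
  rw [lintegral_add_left (by fun_prop), lintegral_add_left (by fun_prop),
    lintegral_const_mul _ hu, lintegral_const_mul _ hh, hh1, hu1, mul_one] at hint
  simp only [Pi.mul_apply, mul_comm (h _), mul_comm (u _)]
  -- If `F r = ∞` it cannot be cancelled. Then `F = ∞` on `|x| ≤ r`, so a finite right side forces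
  -- `u = 0` almost everywhere there; thus `u ≤ h` a.e., and equal masses make them equal a.e.
  rcases eq_or_ne (F r) ∞ with htop | htop
  · by_cases hfin : ∫⁻ x, F x * u x = ∞
    · rw [hfin]
      exact le_top
    have huh : u ≤ᵐ[volume] h := by
      filter_upwards [ae_lt_top (by fun_prop) hfin] with x hx
      rcases le_or_gt |x| r with hxr | hxr
      · have hFx : F x = ∞ := top_le_iff.1 (htop ▸ hF.anti (hxr.trans (le_abs_self r)))
        rw [hFx] at hx
        rcases eq_or_ne (u x) 0 with h0 | h0
        · rw [h0]
          exact zero_le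
        · exact absurd hx (by simp [ENNReal.top_mul h0])
      · exact hout x hxr
    have heq : u =ᵐ[volume] h :=
      ae_eq_of_ae_le_of_lintegral_le huh (by simp [hu1]) hh.aemeasurable (by simp [hu1, hh1])
    refine (lintegral_congr_ae ?_).le
    filter_upwards [heq] with x hx
    rw [hx]
  · exact (ENNReal.add_le_add_iff_left htop).1 hint

/-! ### Sums of independent variables -/

theorem lintegral_pi_succ_sum {n : ℕ} (ν : Fin (n + 1) → Measure ℝ)
    [∀ i, IsProbabilityMeasure (ν i)] {F : ℝ → ℝ≥0∞} (hF : Measurable F) :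
    ∫⁻ p, F (∑ i, p i) ∂Measure.pi ν =
      ∫⁻ q, ∫⁻ y, F (y + ∑ i, q i) ∂(ν 0) ∂(Measure.pi fun i : Fin n => ν i.succ) := by
  have hmp := measurePreserving_piFinSuccAbove ν 0
  have h := hmp.lintegral_comp (f := fun z : ℝ × (Fin n → ℝ) => F (z.1 + ∑ i, z.2 i))
    (by fun_prop)
  rw [lintegral_prod_symm _ (by fun_prop)] at h
  simp only [Fin.succAbove_zero] at h
  rw [← h]
  refine lintegral_congr fun p => ?_
  simp [Fin.sum_univ_succ, MeasurableEquiv.piFinSuccAbove, Fin.tail]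

theorem symmUnimodal_map_sum_pi {n : ℕ} (ν : Fin n → Measure ℝ) [∀ i, IsProbabilityMeasure (ν i)]
    (h : ∀ i, SymmUnimodal (ν i)) {F : ℝ → ℝ≥0∞} (hF : UnimodalFun F) :
    UnimodalFun fun c => ∫⁻ p, F (c + ∑ i, p i) ∂Measure.pi ν := by
  induction n generalizing F with
  | zero => simpa using hF
  | succ n ih =>
    have hm := hF.measurable
    have := ih (fun i : Fin n => ν i.succ) (fun i => h i.succ) (h 0 F hF)
    convert this using 2 with c
    rw [lintegral_pi_succ_sum ν (F := fun y => F (c + y)) (by fun_prop)]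
    refine lintegral_congr fun q => lintegral_congr fun y => ?_
    congr 1
    ring

/-- The peakedness order is preserved by sums of independent symmetric unimodal variables. -/
theorem LessPeaked.lintegral_pi_le {n : ℕ} (μ ν : Fin n → Measure ℝ)
    [∀ i, IsProbabilityMeasure (μ i)] [∀ i, IsProbabilityMeasure (ν i)]
    (hμ : ∀ i, SymmUnimodal (μ i)) (hν : ∀ i, SymmUnimodal (ν i))
    (h : ∀ i, LessPeaked (μ i) (ν i)) {F : ℝ → ℝ≥0∞} (hF : UnimodalFun F) :
    ∫⁻ p, F (∑ i, p i) ∂Measure.pi μ ≤ ∫⁻ p, F (∑ i, p i) ∂Measure.pi ν := by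
  induction n generalizing F with
  | zero => simp
  | succ n ih =>
    have hm := hF.measurable
    rw [lintegral_pi_succ_sum μ hm, lintegral_pi_succ_sum ν hm]
    have h0 := hμ 0 F hF
    calc ∫⁻ q, ∫⁻ y, F (y + ∑ i, q i) ∂(μ 0) ∂(Measure.pi fun i : Fin n => μ i.succ)
        = ∫⁻ q, ∫⁻ y, F ((∑ i, q i) + y) ∂(μ 0) ∂(Measure.pi fun i : Fin n => μ i.succ) := by
          simp only [add_comm]
      -- Summands are exchanged in turn: integrating out the unchanged ones leaves an even unimodal
      -- function, to which the comparison of the others applies.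
      _ ≤ ∫⁻ q, ∫⁻ y, F ((∑ i, q i) + y) ∂(μ 0) ∂(Measure.pi fun i : Fin n => ν i.succ) :=
          ih _ _ (fun i => hμ i.succ) (fun i => hν i.succ) (fun i => h i.succ) h0
      _ = ∫⁻ y, ∫⁻ q, F (y + ∑ i, q i) ∂(Measure.pi fun i : Fin n => ν i.succ) ∂(μ 0) := by
          rw [lintegral_lintegral_swap]
          · simp only [add_comm]
          · exact Measurable.aemeasurable (by fun_prop)
      _ ≤ ∫⁻ y, ∫⁻ q, F (y + ∑ i, q i) ∂(Measure.pi fun i : Fin n => ν i.succ) ∂(ν 0) :=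
          h 0 _ (symmUnimodal_map_sum_pi _ (fun i => hν i.succ) hF)
      _ = _ := by
          rw [lintegral_lintegral_swap]
          exact Measurable.aemeasurable (by fun_prop)

theorem lintegral_pi_map_sum {n : ℕ} (μ : Fin n → Measure ℝ) [∀ i, IsProbabilityMeasure (μ i)]
    {f : Fin n → ℝ → ℝ} (hf : ∀ i, Measurable (f i)) {F : ℝ → ℝ≥0∞} (hF : Measurable F) :
    ∫⁻ p, F (∑ i, p i) ∂(Measure.pi fun i => (μ i).map (f i)) =
      ∫⁻ x, F (∑ i, f i (x i)) ∂Measure.pi μ := by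
  have : ∀ i, IsProbabilityMeasure ((μ i).map (f i)) := fun i =>
    Measure.isProbabilityMeasure_map (hf i).aemeasurable
  rw [← Measure.pi_map_pi fun i => (hf i).aemeasurable, lintegral_map (by fun_prop) (by fun_prop)]

theorem lintegral_indicator_abs_le {Ω : Type*} [MeasurableSpace Ω] (P : Measure Ω) {Y : Ω → ℝ}
    (hY : Measurable Y) (s : ℝ) :
    ∫⁻ ω, {x : ℝ | |x| ≤ s}.indicator (fun _ => 1) (Y ω) ∂P = P {ω | |Y ω| ≤ s} := by
  rw [← lintegral_indicator_one (measurableSet_le (by fun_prop) (by fun_prop))]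
  rfl

/-- A sum of independent symmetric unimodal variables is most concentrated around the origin. -/
theorem measure_pi_abs_sum_sub_le {n : ℕ} (μ : Fin n → Measure ℝ)
    [∀ i, IsProbabilityMeasure (μ i)] {f : Fin n → ℝ → ℝ} (hf : ∀ i, Measurable (f i))
    (h : ∀ i, SymmUnimodal ((μ i).map (f i))) (s c : ℝ) :
    Measure.pi μ {x | |∑ i, f i (x i) - c| ≤ s} ≤ Measure.pi μ {x | |∑ i, f i (x i)| ≤ s} := by
  have : ∀ i, IsProbabilityMeasure ((μ i).map (f i)) := fun i =>
    Measure.isProbabilityMeasure_map (hf i).aemeasurable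
  have hU := UnimodalFun.indicator_abs_le s 1
  have key := (symmUnimodal_map_sum_pi _ h hU).anti (x := 0) (y := -c) (by simp)
  have hm := hU.measurable
  rw [lintegral_pi_map_sum μ hf
      (F := fun y => {x : ℝ | |x| ≤ s}.indicator (fun _ => 1) (-c + y)) (by fun_prop),
    lintegral_pi_map_sum μ hf
      (F := fun y => {x : ℝ | |x| ≤ s}.indicator (fun _ => 1) (0 + y)) (by fun_prop),
    lintegral_indicator_abs_le _ (by fun_prop), lintegral_indicator_abs_le _ (by fun_prop)] at key
  simpa [neg_add_eq_sub] using key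

/-- A window of radius `R` is covered by `⌊R / s⌋ + 1` windows of radius `s`, none heavier than the
central one. -/
theorem measureReal_abs_sub_le_mul {Ω : Type*} [MeasurableSpace Ω] (P : Measure Ω)
    [IsProbabilityMeasure P] (Y : Ω → ℝ) {s : ℝ} (hs : 0 < s)
    (h : ∀ c, P.real {ω | |Y ω - c| ≤ s} ≤ P.real {ω | |Y ω| ≤ s}) (c : ℝ) {R : ℝ}
    (hR : 0 ≤ R) :
    P.real {ω | |Y ω - c| ≤ R} ≤ (R / s + 1) * P.real {ω | |Y ω| ≤ s} := by
  set N := ⌊R / s⌋₊ + 1 with hN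
  have hsub : {ω | |Y ω - c| ≤ R} ⊆
      ⋃ k ∈ Finset.range N, {ω | |Y ω - (c - R + (2 * (k : ℝ) + 1) * s)| ≤ s} := by
    intro ω hω
    simp only [Set.mem_ofPred_eq] at hω
    obtain ⟨h1, h2⟩ := abs_le.1 hω
    have h0 : 0 ≤ (Y ω - c + R) / (2 * s) := div_nonneg (by linarith) (by linarith)
    have hle := Nat.floor_le h0
    have hlt := Nat.lt_floor_add_one ((Y ω - c + R) / (2 * s))
    set k := ⌊(Y ω - c + R) / (2 * s)⌋₊ with hk
    rw [le_div_iff₀ (by positivity)] at hle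
    rw [div_lt_iff₀ (by positivity)] at hlt
    simp only [Set.mem_iUnion, Finset.mem_range, Set.mem_ofPred_eq]
    refine ⟨k, ?_, ?_⟩
    · rw [hN, Nat.lt_succ_iff]
      refine Nat.floor_le_floor ?_
      rw [div_le_div_iff₀ (by positivity) hs]
      nlinarith
    · rw [abs_le]
      constructor <;> nlinarith
  calc P.real {ω | |Y ω - c| ≤ R}
      ≤ P.real (⋃ k ∈ Finset.range N, {ω | |Y ω - (c - R + (2 * (k : ℝ) + 1) * s)| ≤ s}) :=
        measureReal_mono hsub (measure_ne_top _ _)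
    _ ≤ ∑ k ∈ Finset.range N, P.real {ω | |Y ω - (c - R + (2 * (k : ℝ) + 1) * s)| ≤ s} :=
        measureReal_biUnion_finset_le _ _
    _ ≤ ∑ _k ∈ Finset.range N, P.real {ω | |Y ω| ≤ s} := Finset.sum_le_sum fun k _ => h _
    _ = N * P.real {ω | |Y ω| ≤ s} := by simp
    _ ≤ _ := by
        gcongr
        rw [hN]
        push_cast
        gcongr
        exact Nat.floor_le (by positivity)

/-! ### Truncated Gaussians and the lower bound -/

theorem unimodalFun_gaussianPDF : UnimodalFun (gaussianPDF 0 1) := by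
  refine ⟨measurable_gaussianPDF 0 1, fun x y h => ?_⟩
  have := sq_le_sq.2 h
  simp only [gaussianPDF, gaussianPDFReal, sub_zero]
  gcongr ENNReal.ofReal (_ * Real.exp (-?_ / _))

theorem measurableSet_abs_le (a : ℝ) : MeasurableSet {x : ℝ | |x| ≤ a} :=
  measurableSet_le (by fun_prop) (by fun_prop)

theorem measurable_trunc (a : ℝ) : Measurable (trunc a) :=
  Measurable.ite (measurableSet_abs_le a) measurable_id measurable_const

theorem gaussianReal_restrict_abs_le (a : ℝ) :
    (gaussianReal 0 1).restrict {x | |x| ≤ a} =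
      volume.withDensity ({x : ℝ | |x| ≤ a}.indicator (gaussianPDF 0 1)) := by
  rw [gaussianReal_of_var_ne_zero 0 one_ne_zero, restrict_withDensity (measurableSet_abs_le a),
    withDensity_indicator (measurableSet_abs_le a)]

theorem unimodalFun_indicator_gaussianPDF (a : ℝ) :
    UnimodalFun ({x : ℝ | |x| ≤ a}.indicator (gaussianPDF 0 1)) := by
  have := (UnimodalFun.indicator_abs_le a 1).mul unimodalFun_gaussianPDF
  convert this using 2 with x
  by_cases hx : |x| ≤ a <;> simp [Set.indicator, hx]

/-- The law splits into the Gaussian restricted to `[-a, a]`, which has an even unimodal density,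
and an atom at 0 carrying the tail mass. -/
theorem symmUnimodal_map_trunc (a : ℝ) : SymmUnimodal ((gaussianReal 0 1).map (trunc a)) := by
  set S := {x : ℝ | |x| ≤ a} with hS
  have hSm : MeasurableSet S := measurableSet_abs_le a
  have h1 : ((gaussianReal 0 1).restrict S).map (trunc a) = (gaussianReal 0 1).restrict S := by
    conv_rhs => rw [← Measure.map_id (μ := (gaussianReal 0 1).restrict S)]
    refine Measure.map_congr ?_
    filter_upwards [ae_restrict_mem hSm] with x hx
    exact if_pos hx
  have h2 : ((gaussianReal 0 1).restrict Sᶜ).map (trunc a) =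
      gaussianReal 0 1 Sᶜ • Measure.dirac 0 := by
    rw [← Measure.restrict_apply_univ, ← Measure.map_const]
    refine Measure.map_congr ?_
    filter_upwards [ae_restrict_mem hSm.compl] with x hx
    exact if_neg hx
  have h3 : (gaussianReal 0 1).map (trunc a) =
      (gaussianReal 0 1).restrict S + gaussianReal 0 1 Sᶜ • Measure.dirac 0 := by
    conv_lhs => rw [← Measure.restrict_add_restrict_compl (μ := gaussianReal 0 1) hSm]
    rw [Measure.map_add _ _ (measurable_trunc a), h1, h2]
  rw [h3]
  refine SymmUnimodal.add ?_ (SymmUnimodal.dirac_zero.smul _)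
  rw [gaussianReal_restrict_abs_le]
  exact SymmUnimodal.withDensity (unimodalFun_indicator_gaussianPDF a)

theorem abs_trunc_le {a : ℝ} (ha : 0 ≤ a) (x : ℝ) : |trunc a x| ≤ a := by
  unfold trunc
  split_ifs with h
  · exact h
  · simpa using ha

theorem abs_trunc_le_abs (a x : ℝ) : |trunc a x| ≤ |x| := by
  unfold trunc
  split_ifs <;> simp

theorem memLp_trunc {a : ℝ} (ha : 0 ≤ a) : MemLp (trunc a) 2 (gaussianReal 0 1) :=
  MemLp.of_bound (measurable_trunc a).aestronglyMeasurable a (.of_forall fun x => by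
    simpa using abs_trunc_le ha x)

theorem variance_trunc_le {a : ℝ} (ha : 0 < a) :
    Var[trunc a; gaussianReal 0 1] ≤ (10 * min a (1 / 10)) ^ 2 := by
  have hle : Var[trunc a; gaussianReal 0 1] ≤ ∫ x, trunc a x ^ 2 ∂gaussianReal 0 1 :=
    variance_le_expectation_sq (measurable_trunc a).aestronglyMeasurable
  have hint : Integrable (fun x => trunc a x ^ 2) (gaussianReal 0 1) :=
    (memLp_trunc ha.le).integrable_sq
  -- If the minimum is `a`, use `|trunc a x| ≤ a`; if it is `1/10`, the bound is 1, the variance of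
  -- the untruncated Gaussian.
  rcases min_choice a (1 / 10) with h | h
  · have hb : ∫ x, trunc a x ^ 2 ∂gaussianReal 0 1 ≤ ∫ _x, a ^ 2 ∂gaussianReal 0 1 :=
      integral_mono hint (integrable_const _) fun x => by
        have := abs_trunc_le ha.le x
        exact sq_le_sq' (by linarith [(abs_le.1 this).1]) (abs_le.1 this).2
    rw [h]
    simp only [integral_const, probReal_univ, smul_eq_mul, one_mul] at hb
    nlinarith [sq_nonneg a]
  · have hid : MemLp id 2 (gaussianReal 0 1) := memLp_id_gaussianReal' 2 (by simp)
    have hb : ∫ x, trunc a x ^ 2 ∂gaussianReal 0 1 ≤ ∫ x, x ^ 2 ∂gaussianReal 0 1 :=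
      integral_mono hint hid.integrable_sq fun x => sq_le_sq.2 (abs_trunc_le_abs a x)
    have hv := variance_id_gaussianReal (μ := 0) (v := 1)
    rw [variance_eq_sub hid] at hv
    simp [integral_id_gaussianReal] at hv
    rw [h]
    linarith

theorem le_measureReal_smallBall {n : ℕ} (α : EuclideanSpace ℝ (Fin n)) {a δ : ℝ} (ha : 0 < a)
    (hδ : 0 < δ) (hδ1 : δ ≤ 1) :
    1 / 28 * δ ≤ (stdGaussianLaw n).real (smallBall α a δ) := by
  have : IsProbabilityMeasure (stdGaussianLaw n) := by unfold stdGaussianLaw; infer_instance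
  rcases eq_or_ne α 0 with rfl | hα
  · have : smallBall (0 : EuclideanSpace ℝ (Fin n)) a δ = Set.univ := by
      ext x
      simp [smallBall, linForm]
    rw [this, probReal_univ]
    linarith
  set m := min a (1 / 10) with hm
  have hm0 : 0 < m := by rw [hm]; positivity
  have hα0 : 0 < ‖α‖ := norm_pos_iff.2 hα
  set Y : (Fin n → ℝ) → ℝ := fun x => ∑ i, α i * trunc a (x i) with hY
  set s := m * δ * ‖α‖ with hs
  have hs0 : 0 < s := by positivity
  have hset : smallBall α a δ = {x | |Y x| ≤ s} := rfl
  have htm := measurable_trunc a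
  have hfm : ∀ i, Measurable fun x => α i * trunc a x := fun i => by fun_prop
  have hsu : ∀ i, SymmUnimodal ((gaussianReal 0 1).map fun x => α i * trunc a x) := fun i => by
    have : IsProbabilityMeasure ((gaussianReal 0 1).map (trunc a)) :=
      Measure.isProbabilityMeasure_map htm.aemeasurable
    have h := (symmUnimodal_map_trunc a).map_mul_left (α i)
    rwa [Measure.map_map (by fun_prop) htm] at h
  have hconc : ∀ c, (stdGaussianLaw n).real {x | |Y x - c| ≤ s} ≤
      (stdGaussianLaw n).real {x | |Y x| ≤ s} := fun c =>
    ENNReal.toReal_mono (measure_ne_top _ _)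
      (measure_pi_abs_sum_sub_le (fun _ => gaussianReal 0 1) hfm hsu s c)
  have hLp : ∀ i, MemLp (fun x => α i * trunc a x) 2 (gaussianReal 0 1) := fun i =>
    (memLp_trunc ha.le).const_mul (α i)
  have hYsum : Y = ∑ i, fun x => α i * trunc a (x i) := by
    ext x
    simp [hY]
  have hYm : Measurable Y := by rw [hY]; fun_prop
  have hYLp : MemLp Y 2 (stdGaussianLaw n) := by
    rw [hYsum]
    exact memLp_finsetSum' _ fun i _ =>
      (hLp i).comp_measurePreserving (measurePreserving_eval (fun _ => gaussianReal 0 1) i)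
  have hvar : Var[Y; stdGaussianLaw n] ≤ (10 * m) ^ 2 * ‖α‖ ^ 2 := by
    rw [hYsum, stdGaussianLaw, variance_sum_pi (X := fun i x => α i * trunc a x) hLp,
      EuclideanSpace.norm_sq_eq, Finset.mul_sum]
    refine Finset.sum_le_sum fun i _ => ?_
    rw [variance_const_mul, mul_comm, Real.norm_eq_abs, sq_abs]
    gcongr
    exact variance_trunc_le ha
  -- Twice the bound `10 * m * ‖α‖` on the standard deviation, so Chebyshev gives 1/4.
  set R := 20 * m * ‖α‖ with hR
  have hR0 : 0 < R := by positivity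
  set c := ∫ x, Y x ∂stdGaussianLaw n with hc
  have hcheb : (stdGaussianLaw n).real {x | R ≤ |Y x - c|} ≤ 1 / 4 := by
    have h := meas_ge_le_variance_div_sq hYLp hR0
    refine ENNReal.toReal_le_of_le_ofReal (by norm_num) (h.trans (ENNReal.ofReal_le_ofReal ?_))
    rw [div_le_iff₀ (by positivity)]
    refine hvar.trans (le_of_eq ?_)
    rw [hR]
    ring
  have hbig : 3 / 4 ≤ (stdGaussianLaw n).real {x | |Y x - c| ≤ R} := by
    have huniv : (1 : ℝ) ≤ (stdGaussianLaw n).real {x | R ≤ |Y x - c|} +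
        (stdGaussianLaw n).real {x | |Y x - c| ≤ R} := by
      rw [← probReal_univ (μ := stdGaussianLaw n)]
      refine (measureReal_mono fun x _ => ?_).trans (measureReal_union_le _ _)
      exact le_total R |Y x - c|
    linarith
  have hcover := measureReal_abs_sub_le_mul (stdGaussianLaw n) Y hs0 hconc c hR0.le
  have hRs : R / s = 20 / δ := by
    rw [hR, hs]
    field_simp
  rw [hRs] at hcover
  rw [hset]
  set p := (stdGaussianLaw n).real {x | |Y x| ≤ s}
  have hp : 0 ≤ p := measureReal_nonneg
  have h1 : 3 / 4 * δ ≤ (20 + δ) * p := by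
    calc 3 / 4 * δ ≤ ((20 / δ + 1) * p) * δ := by gcongr; exact hbig.trans hcover
      _ = (20 + δ) * p := by field_simp
  -- Since `20 + δ ≤ 21`, the constant is `(3/4) / 21 = 1/28`.
  nlinarith

/-! ### The triangular law and its characteristic function -/

/-- The uniform density on `[-b, b]`. -/
noncomputable def uniformDensity (b : ℝ) : ℝ → ℝ≥0∞ :=
  {x : ℝ | |x| ≤ b}.indicator fun _ => ENNReal.ofReal (1 / (2 * b))

/-- The triangular density on `[-b, b]`. -/
noncomputable def triangularDensity (b x : ℝ) : ℝ≥0∞ := ENNReal.ofReal ((1 - |x| / b) / b)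

/-- The triangular distribution on `[-b, b]`. -/
noncomputable def triangularMeasure (b : ℝ) : Measure ℝ :=
  volume.withDensity (triangularDensity b)

theorem volume_abs_le {a : ℝ} : volume {x : ℝ | |x| ≤ a} = ENNReal.ofReal (2 * a) := by
  have : {x : ℝ | |x| ≤ a} = Set.Icc (-a) a := by
    ext x
    exact (abs_le (a := x))
  rw [this, Real.volume_Icc]
  ring_nf

theorem measurable_uniformDensity (b : ℝ) : Measurable (uniformDensity b) :=
  measurable_const.indicator (measurableSet_abs_le b)

theorem lintegral_uniformDensity {b : ℝ} (hb : 0 < b) : ∫⁻ x, uniformDensity b x = 1 := by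
  unfold uniformDensity
  rw [lintegral_indicator (measurableSet_abs_le b), setLIntegral_const, volume_abs_le,
    ← ENNReal.ofReal_mul (by positivity)]
  field_simp
  simp

theorem unimodalFun_triangularDensity {b : ℝ} (hb : 0 < b) :
    UnimodalFun (triangularDensity b) := by
  refine ⟨by unfold triangularDensity; fun_prop, fun x y h => ?_⟩
  unfold triangularDensity
  gcongr

theorem integral_triangularDensity_mul {b : ℝ} (hb : 0 < b) {g : ℝ → ℝ} (hg : ∀ x, g |x| = g x) :
    ∫ x, (triangularDensity b x).toReal * g x =
      ∫ x in 0..b, 2 * ((1 - x / b) / b) * g x := by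
  have h1 : ∀ x, (triangularDensity b x).toReal * g x =
      (fun y => max ((1 - y / b) / b) 0 * g y) |x| := fun x => by
    simp only [triangularDensity, ENNReal.toReal_ofReal', hg]
  rw [integral_congr_ae (.of_forall h1),
    integral_comp_abs (f := fun y => max ((1 - y / b) / b) 0 * g y), intervalIntegral.integral_of_le hb.le, ← integral_const_mul]
  symm
  rw [← integral_indicator measurableSet_Ioc, ← integral_indicator measurableSet_Ioi]
  congr 1
  ext x
  by_cases hx0 : 0 < x
  · by_cases hxb : x ≤ b
    · have : 0 ≤ (1 - x / b) / b := by
        have : x / b ≤ 1 := (div_le_one hb).2 hxb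
        exact div_nonneg (by linarith) hb.le
      simp [Set.indicator, hx0, hxb, max_eq_left this, mul_assoc]
    · have : (1 - x / b) / b ≤ 0 := by
        have : 1 ≤ x / b := (one_le_div hb).2 (le_of_not_ge hxb)
        exact div_nonpos_of_nonpos_of_nonneg (by linarith) hb.le
      simp [Set.indicator, hx0, hxb, max_eq_right this]
  · simp [Set.indicator, hx0]

theorem integrable_triangularDensity {b : ℝ} (hb : 0 < b) :
    Integrable fun x => (triangularDensity b x).toReal := by
  have hc : Continuous fun x : ℝ => (triangularDensity b x).toReal := by
    simp only [triangularDensity, ENNReal.toReal_ofReal']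
    fun_prop
  refine hc.integrable_of_hasCompactSupport (HasCompactSupport.intro (isCompact_Icc (a := -b)
    (b := b)) fun x hx => ?_)
  have hx' : b < |x| := by
    exact not_le.1 fun h => hx (abs_le.1 h)
  have : 1 ≤ |x| / b := (one_le_div hb).2 hx'.le
  simp only [triangularDensity]
  rw [ENNReal.ofReal_eq_zero.2 (div_nonpos_of_nonpos_of_nonneg (by linarith) hb.le)]
  simp

theorem lintegral_triangularDensity {b : ℝ} (hb : 0 < b) :
    ∫⁻ x, triangularDensity b x = 1 := by
  have h := integral_triangularDensity_mul hb (g := fun _ => 1) (fun _ => rfl)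
  have h2 : ∫ x in 0..b, 2 * ((1 - x / b) / b) * 1 = 1 := by
    have hd : ∀ x ∈ Set.uIcc 0 b, HasDerivAt (fun x => 2 / b * (x - x ^ 2 / (2 * b)))
        (2 * ((1 - x / b) / b) * 1) x := fun x _ => by
      refine (((hasDerivAt_id x).sub
        ((hasDerivAt_pow 2 x).div_const (2 * b))).const_mul (2 / b)).congr_deriv ?_
      simp
      field_simp
    rw [intervalIntegral.integral_eq_sub_of_hasDerivAt hd
      ((by fun_prop : Continuous _).intervalIntegrable _ _)]
    field_simp
    ring
  rw [h2] at h
  simp only [mul_one] at h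
  have h3 := ofReal_integral_eq_lintegral_ofReal (integrable_triangularDensity hb)
    (.of_forall fun x => ENNReal.toReal_nonneg)
  rw [h] at h3
  simpa [triangularDensity] using h3.symm

theorem isProbabilityMeasure_triangularMeasure {b : ℝ} (hb : 0 < b) :
    IsProbabilityMeasure (triangularMeasure b) :=
  ⟨by simp [triangularMeasure, lintegral_triangularDensity hb]⟩

theorem lessPeaked_uniform_triangular {b : ℝ} (hb : 0 < b) :
    LessPeaked (volume.withDensity (uniformDensity b)) (triangularMeasure b) := by
  -- The triangular density falls to the uniform height `1 / (2 * b)` exactly at `|x| = b / 2`.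
  refine LessPeaked.of_single_crossing (r := b / 2) (measurable_uniformDensity b)
    (unimodalFun_triangularDensity hb).measurable (lintegral_uniformDensity hb)
    (lintegral_triangularDensity hb) (fun x hx => ?_) (fun x hx => ?_) (by positivity)
  · have hxb : |x| ≤ b := by linarith
    simp only [uniformDensity, triangularDensity, Set.indicator, Set.mem_ofPred_eq, hxb, if_true]
    refine ENNReal.ofReal_le_ofReal ?_
    have : |x| / b ≤ 1 / 2 := by rw [div_le_iff₀ hb]; linarith
    rw [← div_div]
    gcongr
    linarith
  · have h1 : 1 / 2 ≤ |x| / b := by rw [le_div_iff₀ hb]; linarith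
    by_cases hxb : |x| ≤ b
    · simp only [uniformDensity, triangularDensity, Set.indicator, Set.mem_ofPred_eq, hxb, if_true]
      refine ENNReal.ofReal_le_ofReal ?_
      rw [← div_div]
      gcongr
      linarith
    · have : 1 ≤ |x| / b := (one_le_div hb).2 (le_of_not_ge hxb)
      rw [triangularDensity, ENNReal.ofReal_eq_zero.2
        (div_nonpos_of_nonpos_of_nonneg (by linarith) hb.le)]
      exact zero_le

/-- For `|y| ≤ 2`, write `sin y = 2 sin (y/2) cos (y/2)` and use `cos t ≤ 1 / √(t² + 1)`; for larger
`|y|`, `sin² ≤ 1` suffices. -/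
theorem sin_sq_mul_le (y : ℝ) : Real.sin y ^ 2 * (1 + y ^ 2 / 4) ≤ y ^ 2 := by
  rcases le_or_gt |y| 2 with hy | hy
  · obtain ⟨h1, h2⟩ := abs_le.1 hy
    have hpi := Real.pi_gt_three
    have hcos := Real.cos_le_one_div_sqrt_sq_add_one (x := y / 2) (by linarith) (by linarith)
    have hcos0 : 0 ≤ Real.cos (y / 2) :=
      Real.cos_nonneg_of_neg_pi_div_two_le_of_le (by linarith) (by linarith)
    have hc2 : Real.cos (y / 2) ^ 2 * (1 + y ^ 2 / 4) ≤ 1 := by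
      have h := pow_le_pow_left₀ hcos0 hcos 2
      rw [div_pow, Real.sq_sqrt (by positivity), one_pow, le_div_iff₀ (by positivity)] at h
      linarith
    have hs2 : Real.sin (y / 2) ^ 2 ≤ (y / 2) ^ 2 := sq_le_sq.2 Real.abs_sin_le_abs
    have hsin : Real.sin y = 2 * Real.sin (y / 2) * Real.cos (y / 2) := by
      rw [← Real.sin_two_mul]
      congr 1
      ring
    calc Real.sin y ^ 2 * (1 + y ^ 2 / 4)
        = 4 * Real.sin (y / 2) ^ 2 * (Real.cos (y / 2) ^ 2 * (1 + y ^ 2 / 4)) := by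
          rw [hsin]; ring
      _ ≤ 4 * (y / 2) ^ 2 * 1 := by gcongr
      _ = y ^ 2 := by ring
  · have h4 : 4 < y ^ 2 := by
      rw [← sq_abs]
      nlinarith
    have := Real.sin_sq_le_one y
    nlinarith [sq_nonneg y]

theorem integral_triangular_cos_le {b : ℝ} (hb : 0 < b) {u : ℝ} (hu : u ≠ 0) :
    |∫ x in 0..b, 2 * ((1 - x / b) / b) * Real.cos (u * x)| ≤ (1 + (u * b) ^ 2 / 16)⁻¹ := by
  have hd : ∀ x ∈ Set.uIcc 0 b, HasDerivAt
      (fun x => 2 / b * ((1 - x / b) * Real.sin (u * x) / u - Real.cos (u * x) / (b * u ^ 2)))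
      (2 * ((1 - x / b) / b) * Real.cos (u * x)) x := fun x _ => by
    have hl : HasDerivAt (fun x : ℝ => u * x) u x := by
      simpa using (hasDerivAt_id x).const_mul u
    have ha : HasDerivAt (fun x : ℝ => 1 - x / b) (-(1 / b)) x := by
      simpa using ((hasDerivAt_id x).div_const b).const_sub 1
    refine ((((ha.mul hl.sin).div_const u).sub
      (hl.cos.div_const (b * u ^ 2))).const_mul (2 / b)).congr_deriv ?_
    field_simp
    ring
  rw [intervalIntegral.integral_eq_sub_of_hasDerivAt hd
    ((by fun_prop : Continuous _).intervalIntegrable _ _)]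
  have hs := sin_sq_mul_le (u * b / 2)
  have hcos : Real.cos (u * b) = 1 - 2 * Real.sin (u * b / 2) ^ 2 := by
    rw [← Real.cos_two_mul_eq_one_sub]
    congr 1
    ring
  -- The cosine transform is the squared sinc at `u * b / 2`.
  have heq : 2 / b * ((1 - b / b) * Real.sin (u * b) / u - Real.cos (u * b) / (b * u ^ 2)) -
      2 / b * ((1 - 0 / b) * Real.sin (u * 0) / u - Real.cos (u * 0) / (b * u ^ 2)) =
      Real.sin (u * b / 2) ^ 2 / (u * b / 2) ^ 2 := by
    rw [hcos]
    simp
    field_simp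
    ring
  rw [heq, abs_of_nonneg (by positivity), div_le_iff₀ (by positivity), ← div_eq_inv_mul,
    le_div_iff₀ (by positivity)]
  refine le_trans (le_of_eq ?_) hs
  ring

theorem norm_charFun_triangularMeasure_le {b : ℝ} (hb : 0 < b) (u : ℝ) :
    ‖charFun (triangularMeasure b) u‖ ≤ (1 + (u * b) ^ 2 / 16)⁻¹ := by
  have := isProbabilityMeasure_triangularMeasure hb
  rcases eq_or_ne u 0 with rfl | hu
  · simp
  have hform : ∀ v : ℝ, charFun (triangularMeasure b) v =
      ∫ x, ((triangularDensity b x).toReal : ℂ) * Complex.exp (v * x * Complex.I) := fun v => by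
    rw [charFun_apply_real, triangularMeasure, integral_withDensity_eq_integral_toReal_smul
      (unimodalFun_triangularDensity hb).measurable
      (.of_forall fun _ => ENNReal.ofReal_lt_top)]
    simp
  have hint : ∀ v : ℝ, Integrable fun x : ℝ =>
      ((triangularDensity b x).toReal : ℂ) * Complex.exp (v * x * Complex.I) := fun v => by
    refine (integrable_triangularDensity hb).ofReal.mul_bdd (c := 1) (by fun_prop) ?_
    refine .of_forall fun x => ?_
    rw [← Complex.ofReal_mul, Complex.norm_exp_ofReal_mul_I]
  have hneg : charFun (triangularMeasure b) (-u) = charFun (triangularMeasure b) u := by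
    rw [hform, hform, ← integral_neg_eq_self]
    refine integral_congr_ae (.of_forall fun x => ?_)
    simp [triangularDensity]
  have h2 : 2 * charFun (triangularMeasure b) u =
      2 * ((∫ x, (triangularDensity b x).toReal * Real.cos (u * x) : ℝ) : ℂ) := by
    conv_lhs => rw [two_mul]
    nth_rewrite 2 [← hneg]
    rw [hform, hform, ← integral_add (hint _) (hint _), ← integral_complex_ofReal, ← integral_const_mul]
    refine integral_congr_ae (.of_forall fun x => ?_)
    simp only [Complex.ofReal_mul, Complex.ofReal_cos, Complex.cos, Complex.ofReal_neg]
    ring_nf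
  rw [mul_left_cancel₀ two_ne_zero h2, Complex.norm_real, Real.norm_eq_abs,
    integral_triangularDensity_mul hb (g := fun x => Real.cos (u * x))]
  · exact integral_triangular_cos_le hb hu
  · intro x
    rcases abs_choice x with h | h <;> simp [h]

/-! ### Fourier bound for triangular sums and anti-concentration -/

/-- Averaging the Gaussian kernel against `σ` amounts to averaging the characteristic function of
`σ` against the Gaussian law. -/
theorem integral_exp_neg_sq_eq_integral_charFun (σ : Measure ℝ) [IsProbabilityMeasure σ] :
    ∫ y : ℝ, Complex.exp (-(y : ℂ) ^ 2 / 2) ∂σ = ∫ g, charFun σ g ∂gaussianReal 0 1 := by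
  have h : ∀ y : ℝ, Complex.exp (-(y : ℂ) ^ 2 / 2) =
      ∫ g : ℝ, Complex.exp (y * g * Complex.I) ∂gaussianReal 0 1 := fun y => by
    rw [← charFun_apply_real, charFun_gaussianReal]
    simp
    ring_nf
  simp only [h, charFun_apply_real]
  rw [integral_integral_swap]
  · refine integral_congr_ae (.of_forall fun x => ?_)
    refine integral_congr_ae (.of_forall fun y => ?_)
    simp only [mul_comm (x : ℂ)]
  · refine Integrable.of_bound (C := 1) ?_ (.of_forall fun p => ?_)
    · exact Measurable.aestronglyMeasurable (by unfold Function.uncurry; fun_prop)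
    · rw [Function.uncurry, ← Complex.ofReal_mul, Complex.norm_exp_ofReal_mul_I]

/-- The Gaussian density is at most 1, which leaves the Cauchy integral, equal to π after rescaling.
-/
theorem integral_gaussianReal_inv_one_add_sq_le {v : ℝ} (hv : 0 < v) :
    ∫ g, (1 + (v * g) ^ 2)⁻¹ ∂gaussianReal 0 1 ≤ Real.pi / v := by
  have hint : Integrable fun g : ℝ => (1 + (v * g) ^ 2)⁻¹ :=
    integrable_inv_one_add_sq.comp_mul_left' hv.ne'
  rw [integral_gaussianReal_eq_integral_smul one_ne_zero]
  calc ∫ g, gaussianPDFReal 0 1 g • (1 + (v * g) ^ 2)⁻¹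
      ≤ ∫ g, (1 + (v * g) ^ 2)⁻¹ := by
        refine integral_mono_of_nonneg (.of_forall fun g => ?_) hint (.of_forall fun g => ?_)
        · exact mul_nonneg (gaussianPDFReal_nonneg _ _ _) (by positivity)
        · refine mul_le_of_le_one_left (by positivity) ?_
          rw [gaussianPDFReal]
          refine mul_le_one₀ (inv_le_one_of_one_le₀ ?_) (Real.exp_nonneg _)
            (Real.exp_le_one_iff.2 ?_)
          · rw [Real.one_le_sqrt]
            have := Real.pi_gt_three
            simp
            linarith
          · rw [neg_div, neg_nonpos]
            positivity
    _ = Real.pi / v := by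
        rw [Measure.integral_comp_mul_left (fun g => (1 + g ^ 2)⁻¹), integral_univ_inv_one_add_sq,
          abs_of_pos (inv_pos.2 hv), smul_eq_mul, div_eq_inv_mul]

theorem one_add_sum_le_prod_one_add {ι : Type*} (s : Finset ι) {f : ι → ℝ} (hf : ∀ i, 0 ≤ f i) :
    1 + ∑ i ∈ s, f i ≤ ∏ i ∈ s, (1 + f i) := by
  classical
  induction s using Finset.induction_on with
  | empty => simp
  | insert i s hi ih =>
    rw [Finset.sum_insert hi, Finset.prod_insert hi]
    have := hf i
    have := Finset.sum_nonneg fun j (_ : j ∈ s) => hf j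
    nlinarith

theorem integral_exp_neg_sq_triangular_le {n : ℕ} (β : Fin n → ℝ) {b v : ℝ} (hb : 0 < b)
    (hv : 0 < v) (hβ : v ^ 2 ≤ ∑ i, (β i * b) ^ 2 / 16) :
    ∫ p, Real.exp (-(∑ i, p i) ^ 2 / 2)
      ∂(Measure.pi fun i => (triangularMeasure b).map fun x => β i * x) ≤ Real.pi / v := by
  have := isProbabilityMeasure_triangularMeasure hb
  have : ∀ i, IsProbabilityMeasure ((triangularMeasure b).map fun x => β i * x) := fun i =>
    Measure.isProbabilityMeasure_map (by fun_prop)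
  set ν := fun i => (triangularMeasure b).map fun x => β i * x with hν
  set σ := (Measure.pi ν).map fun p => ∑ i, p i with hσ
  have : IsProbabilityMeasure σ := Measure.isProbabilityMeasure_map (by fun_prop)
  have h1 : ∫ p, Real.exp (-(∑ i, p i) ^ 2 / 2) ∂Measure.pi ν = ∫ y, Real.exp (-y ^ 2 / 2) ∂σ := by
    rw [hσ, integral_map (by fun_prop) (by fun_prop)]
  have h2 : ((∫ y, Real.exp (-y ^ 2 / 2) ∂σ : ℝ) : ℂ) = ∫ g, charFun σ g ∂gaussianReal 0 1 := by
    rw [← integral_exp_neg_sq_eq_integral_charFun, ← integral_complex_ofReal]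
    simp
  have h3 : ∀ g, ‖charFun σ g‖ ≤ (1 + (v * g) ^ 2)⁻¹ := fun g => by
    rw [hσ, charFun_map_sum_pi_eq_prod, Finset.prod_apply, norm_prod]
    calc ∏ i, ‖charFun (ν i) g‖ ≤ ∏ i, (1 + (β i * g * b) ^ 2 / 16)⁻¹ := by
          refine Finset.prod_le_prod (fun i _ => norm_nonneg _) fun i _ => ?_
          rw [hν, charFun_map_mul]
          exact norm_charFun_triangularMeasure_le hb _
      _ = (∏ i, (1 + (β i * g * b) ^ 2 / 16))⁻¹ := Finset.prod_inv_distrib _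
      _ ≤ (1 + (v * g) ^ 2)⁻¹ := by
          refine inv_anti₀ (by positivity) ?_
          refine le_trans ?_ (one_add_sum_le_prod_one_add _ fun i => by positivity)
          gcongr
          calc (v * g) ^ 2 = v ^ 2 * g ^ 2 := by ring
            _ ≤ (∑ i, (β i * b) ^ 2 / 16) * g ^ 2 := by gcongr
            _ = ∑ i, (β i * g * b) ^ 2 / 16 := by
              rw [Finset.sum_mul]
              exact Finset.sum_congr rfl fun i _ => by ring
  have hint : Integrable (fun g : ℝ => (1 + (v * g) ^ 2)⁻¹) (gaussianReal 0 1) := by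
    refine Integrable.of_bound (C := 1) (by fun_prop) (.of_forall fun g => ?_)
    rw [Real.norm_of_nonneg (by positivity)]
    exact inv_le_one_of_one_le₀ (by nlinarith [sq_nonneg (v * g)])
  calc ∫ p, Real.exp (-(∑ i, p i) ^ 2 / 2) ∂Measure.pi ν
      ≤ ‖∫ g, charFun σ g ∂gaussianReal 0 1‖ := by
        rw [h1, ← h2, Complex.norm_real]
        exact Real.le_norm_self _
    _ ≤ ∫ g, (1 + (v * g) ^ 2)⁻¹ ∂gaussianReal 0 1 :=
        norm_integral_le_of_norm_le hint (.of_forall h3)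
    _ ≤ _ := integral_gaussianReal_inv_one_add_sq_le hv

theorem unimodalFun_exp_neg_sq : UnimodalFun fun y => ENNReal.ofReal (Real.exp (-y ^ 2 / 2)) := by
  refine ⟨by fun_prop, fun x y h => ?_⟩
  have := sq_le_sq.2 h
  gcongr ENNReal.ofReal (Real.exp (-?_ / _))

/-- Sums of independent variables that are symmetric unimodal and less peaked than a triangular
variable are anti-concentrated. -/
theorem measure_pi_abs_sum_le_of_lessPeaked {n : ℕ} (ρ : Measure ℝ) [IsProbabilityMeasure ρ]
    (hρ : SymmUnimodal ρ) (β : Fin n → ℝ) {b v : ℝ} (hb : 0 < b)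
    (hpk : LessPeaked ρ (triangularMeasure b))
    (hv : 0 < v) (hβ : v ^ 2 ≤ ∑ i, (β i * b) ^ 2 / 16) :
    (Measure.pi fun _ => ρ).real {x | |∑ i, β i * x i| ≤ 1} ≤
      Real.exp (1 / 2) * (Real.pi / v) := by
  have := isProbabilityMeasure_triangularMeasure hb
  have hτ : SymmUnimodal (triangularMeasure b) :=
    SymmUnimodal.withDensity (unimodalFun_triangularDensity hb)
  have : ∀ i, IsProbabilityMeasure ((triangularMeasure b).map fun x => β i * x) := fun i =>
    Measure.isProbabilityMeasure_map (by fun_prop)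
  have : ∀ i, IsProbabilityMeasure (ρ.map fun x => β i * x) := fun i =>
    Measure.isProbabilityMeasure_map (by fun_prop)
  have hcmp := LessPeaked.lintegral_pi_le (fun i => ρ.map fun x => β i * x)
    (fun i => (triangularMeasure b).map fun x => β i * x)
    (fun i => hρ.map_mul_left (β i)) (fun i => hτ.map_mul_left (β i))
    (fun i => hpk.map_mul_left (β i)) unimodalFun_exp_neg_sq
  rw [lintegral_pi_map_sum (fun _ => ρ) (f := fun i x => β i * x) (fun i => by fun_prop)
    unimodalFun_exp_neg_sq.measurable] at hcmp
  have hint : Integrable (fun p : Fin n → ℝ => Real.exp (-(∑ i, p i) ^ 2 / 2))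
      (Measure.pi fun i => (triangularMeasure b).map fun x => β i * x) := by
    refine Integrable.of_bound (C := 1) (by fun_prop) (.of_forall fun p => ?_)
    rw [Real.norm_of_nonneg (Real.exp_nonneg _), Real.exp_le_one_iff, neg_div, neg_nonpos]
    positivity
  rw [← ofReal_integral_eq_lintegral_ofReal hint (.of_forall fun _ => Real.exp_nonneg _)] at hcmp
  have hle := hcmp.trans (ENNReal.ofReal_le_ofReal
    (integral_exp_neg_sq_triangular_le β hb hv hβ))
  refine ENNReal.toReal_le_of_le_ofReal (by positivity) ?_
  have hmeas : Measurable fun x : Fin n → ℝ => ∑ i, β i * x i := by fun_prop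
  rw [ENNReal.ofReal_mul (Real.exp_nonneg _), ← lintegral_indicator_abs_le _ hmeas]
  refine le_trans ?_ (mul_le_mul_right hle _)
  rw [← lintegral_const_mul _ (by fun_prop)]
  -- Markov's inequality with the Gaussian kernel: `1 ≤ exp (1/2) * exp (-S²/2)` when `|S| ≤ 1`.
  refine lintegral_mono fun x => ?_
  by_cases hx : |∑ i, β i * x i| ≤ 1
  · simp only [Set.indicator, Set.mem_ofPred_eq, hx, if_true]
    rw [← ENNReal.ofReal_mul (Real.exp_nonneg _), ← Real.exp_add, ENNReal.one_le_ofReal,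
      Real.one_le_exp_iff]
    have : (∑ i, β i * x i) ^ 2 ≤ 1 := (sq_le_one_iff_abs_le_one _).2 hx
    linarith
  · simp [Set.indicator, hx]

/-! ### The conditioned Gaussian and the upper bound -/

/-- The standard Gaussian law conditioned on `[-a, a]`. -/
noncomputable def truncGaussian (a : ℝ) : Measure ℝ := cond (gaussianReal 0 1) {x | |x| ≤ a}

theorem setOf_forall_abs_le_eq_pi (n : ℕ) (a : ℝ) :
    {x : Fin n → ℝ | ∀ i, |x i| ≤ a} = Set.univ.pi fun _ => {x | |x| ≤ a} := by
  ext x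
  simp

theorem truncGaussianLaw_eq_pi (n : ℕ) (a : ℝ) [IsProbabilityMeasure (truncGaussian a)] :
    truncGaussianLaw n a = Measure.pi fun _ => truncGaussian a := by
  refine (Measure.pi_eq fun s hs => ?_).symm
  rw [truncGaussianLaw, setOf_forall_abs_le_eq_pi, cond_apply (.univ_pi fun _ => measurableSet_abs_le a),
    ← Set.pi_inter_distrib, stdGaussianLaw, Measure.pi_pi, Measure.pi_pi,
    ENNReal.prod_inv_distrib (fun i _ j _ _ => .inr (measure_ne_top _ _)),
    ← Finset.prod_mul_distrib]
  refine Finset.prod_congr rfl fun i _ => ?_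
  rw [truncGaussian, cond_apply (measurableSet_abs_le a)]

theorem truncGaussian_eq_withDensity (a : ℝ) :
    truncGaussian a = volume.withDensity ((gaussianReal 0 1 {x | |x| ≤ a})⁻¹ •
      {x : ℝ | |x| ≤ a}.indicator (gaussianPDF 0 1)) := by
  rw [withDensity_smul _ (unimodalFun_indicator_gaussianPDF a).measurable,
    ← gaussianReal_restrict_abs_le]
  rfl

/-- The mass of `[-a, a]` is at least that of `[-m, m]`, hence at least `2 * m` times the density at
`m`, which is at least half the density at 0 because `m ≤ 1`. -/
theorem gaussianPDF_le_mul_measure {a m : ℝ} (hm : 0 < m) (hm1 : m ≤ 1) (hma : m ≤ a) (x : ℝ) :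
    gaussianPDF 0 1 x ≤ ENNReal.ofReal (1 / m) * gaussianReal 0 1 {x | |x| ≤ a} := by
  have h1 : gaussianPDF 0 1 m * ENNReal.ofReal (2 * m) ≤ gaussianReal 0 1 {x | |x| ≤ a} := by
    calc gaussianPDF 0 1 m * ENNReal.ofReal (2 * m)
        = ∫⁻ _ in {x : ℝ | |x| ≤ m}, gaussianPDF 0 1 m := by
          rw [setLIntegral_const, volume_abs_le]
      _ ≤ ∫⁻ y in {x : ℝ | |x| ≤ m}, gaussianPDF 0 1 y :=
          setLIntegral_mono (measurable_gaussianPDF 0 1) fun y hy =>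
            unimodalFun_gaussianPDF.anti (le_trans hy (le_abs_self m))
      _ = gaussianReal 0 1 {x | |x| ≤ m} := (gaussianReal_apply 0 one_ne_zero _).symm
      _ ≤ _ := measure_mono fun y hy => le_trans hy hma
  refine le_trans ?_ (mul_le_mul_right h1 _)
  have h2 : gaussianPDF 0 1 x ≤ gaussianPDF 0 1 0 := unimodalFun_gaussianPDF.anti (by simp)
  refine h2.trans ?_
  have hpos := gaussianPDFReal_nonneg 0 1 m
  rw [gaussianPDF, gaussianPDF, ← ENNReal.ofReal_mul hpos, ← ENNReal.ofReal_mul (by positivity)]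
  refine ENNReal.ofReal_le_ofReal ?_
  have h3 : 1 / m * (gaussianPDFReal 0 1 m * (2 * m)) = 2 * gaussianPDFReal 0 1 m := by
    field_simp
  rw [h3]
  have h4 := Real.add_one_le_exp (-m ^ 2 / 2)
  have h5 : 1 ≤ 2 * Real.exp (-m ^ 2 / 2) := by nlinarith
  have h6 : 0 ≤ (√(2 * Real.pi))⁻¹ := by positivity
  simp only [gaussianPDFReal, NNReal.coe_one, mul_one, sub_zero]
  rw [zero_pow two_ne_zero, neg_zero, zero_div, Real.exp_zero]
  nlinarith

theorem truncGaussian_properties {a m : ℝ} (hm : 0 < m) (hm1 : m ≤ 1) (hma : m ≤ a) :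
    IsProbabilityMeasure (truncGaussian a) ∧ SymmUnimodal (truncGaussian a) ∧
      LessPeaked (truncGaussian a) (triangularMeasure (m / 2)) := by
  set Z := gaussianReal 0 1 {x | |x| ≤ a} with hZ
  have hpdf := gaussianPDF_le_mul_measure hm hm1 hma
  have hZ0 : Z ≠ 0 := fun h0 => by
    have h := hpdf 0
    rw [← hZ, h0, mul_zero] at h
    exact (gaussianPDF_pos 0 one_ne_zero 0).not_ge h
  have hprob : IsProbabilityMeasure (truncGaussian a) := cond_isProbabilityMeasure hZ0
  have hU := (unimodalFun_indicator_gaussianPDF a).const_mul Z⁻¹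
  have heq := truncGaussian_eq_withDensity a
  refine ⟨hprob, ?_, ?_⟩
  · rw [heq]
    exact SymmUnimodal.withDensity hU
  · refine LessPeaked.trans ?_ (lessPeaked_uniform_triangular (half_pos hm))
    rw [heq]
    -- Inside `[-m/2, m/2]` the conditioned density is at most the uniform height `1/m`; outside,
    -- the uniform density vanishes.
    refine LessPeaked.of_single_crossing (r := m / 2) hU.measurable (measurable_uniformDensity _)
      ?_ (lintegral_uniformDensity (half_pos hm)) (fun x hx => ?_) (fun x hx => ?_)
      (half_pos hm).le
    · have h := hprob.measure_univ
      rwa [heq, withDensity_apply _ .univ, setLIntegral_univ] at h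
    · simp only [uniformDensity, Set.indicator, Set.mem_ofPred_eq, hx, if_true, Pi.smul_apply,
        smul_eq_mul]
      rw [← hZ, mul_comm, ← div_eq_mul_inv,
        ENNReal.div_le_iff hZ0 (measure_ne_top _ _)]
      have h2 : 2 * (m / 2) = m := by ring
      rw [h2]
      split_ifs
      · exact hpdf x
      · exact zero_le
    · simp [uniformDensity, Set.indicator, not_le.2 hx]

theorem measureReal_smallBall_le {n : ℕ} (α : EuclideanSpace ℝ (Fin n)) {a δ : ℝ} (hα : α ≠ 0)
    (ha : 0 < a) (hδ : 0 < δ) :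
    (truncGaussianLaw n a).real (smallBall α a δ) ≤ Real.exp (1 / 2) * 8 * Real.pi * δ := by
  set m := min a (1 / 10) with hm
  have hm0 : 0 < m := by rw [hm]; positivity
  have hm1 : m ≤ 1 := (min_le_right _ _).trans (by norm_num)
  have hα0 : 0 < ‖α‖ := norm_pos_iff.2 hα
  obtain ⟨hprob, hsu, hpk⟩ := truncGaussian_properties hm0 hm1 (min_le_left a (1 / 10))
  set t := m * δ * ‖α‖ with ht
  have ht0 : 0 < t := by positivity
  -- Dividing by `t` rescales the small ball to radius 1; `v = 1 / (8 * δ)` makes the required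
  -- variance condition an equality.
  have hbound := measure_pi_abs_sum_le_of_lessPeaked (truncGaussian a) hsu (fun i => α i / t)
    (half_pos hm0) hpk (v := 1 / (8 * δ)) (by positivity) (by
      have hsum : ∑ i, (α i / t * (m / 2)) ^ 2 / 16 = ‖α‖ ^ 2 * ((m / 2 / t) ^ 2 / 16) := by
        rw [EuclideanSpace.norm_sq_eq, Finset.sum_mul]
        refine Finset.sum_congr rfl fun i _ => ?_
        rw [Real.norm_eq_abs, sq_abs]
        ring
      rw [hsum, ht]
      refine le_of_eq ?_
      field_simp
      norm_num)
  have hrhs : Real.exp (1 / 2) * (Real.pi / (1 / (8 * δ))) =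
      Real.exp (1 / 2) * 8 * Real.pi * δ := by
    field_simp
  rw [hrhs, ← truncGaussianLaw_eq_pi] at hbound
  refine le_trans (le_of_eq ?_) hbound
  have hmeas : MeasurableSet {x : Fin n → ℝ | ∀ i, |x i| ≤ a} := by
    rw [setOf_forall_abs_le_eq_pi]
    exact .univ_pi fun _ => measurableSet_abs_le a
  have hcube : ∀ᵐ x ∂truncGaussianLaw n a, ∀ i, |x i| ≤ a := ae_cond_mem hmeas
  refine measureReal_congr ?_
  filter_upwards [hcube] with x hx
  refine propext ?_
  change |linForm α fun i => trunc a (x i)| ≤ t ↔ |∑ i, α i / t * x i| ≤ 1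
  have h1 : linForm α (fun i => trunc a (x i)) = ∑ i, α i * x i :=
    Finset.sum_congr rfl fun i _ => congrArg (α i * ·) (if_pos (hx i))
  have h2 : ∑ i, α i / t * x i = (∑ i, α i * x i) / t := by
    rw [Finset.sum_div]
    exact Finset.sum_congr rfl fun i _ => by ring
  rw [h1, h2, abs_div, abs_of_pos ht0, div_le_one ht0]

theorem mainTheorem3 :
    (∃ c : ℝ, 0 < c ∧
      ∀ (n : ℕ) (α : EuclideanSpace ℝ (Fin n)) (a δ : ℝ), 0 < a → 0 < δ → δ ≤ 1 →
        c * δ ≤ (stdGaussianLaw n).real (smallBall α a δ)) ∧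
    (∃ C : ℝ, 0 < C ∧
      ∀ (n : ℕ) (α : EuclideanSpace ℝ (Fin n)) (a δ : ℝ), α ≠ 0 → 0 < a → 0 < δ →
        (truncGaussianLaw n a).real (smallBall α a δ) ≤ C * δ) :=
  ⟨⟨1 / 28, by norm_num, fun _ α _ _ ha hδ hδ1 => le_measureReal_smallBall α ha hδ hδ1⟩,
    ⟨Real.exp (1 / 2) * 8 * Real.pi, by positivity,
      fun _ α _ _ hα ha hδ => measureReal_smallBall_le α hα ha hδ⟩⟩
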